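/- Consider bandits with $n$ independent arms, each with a finite set $\mathcal S$ of states. An arm that is not played keeps its state and yields nothing. If arm $i$ is in state $k$ and is played $t\ge 1$ steps after its previous play, it yields the reward $r^i_k\ge 0$ and moves to state $j\ne k$ with probability $q^i_{kj}(t)\ge 0$, staying in $k$ with the remaining probability, where $\sum_{j\ne k}q^i_{kj}(t)\le 1$ and every $q^i_{kj}(t)$ is non-decreasing in $t$. At most one arm is played per step, and the goal is to maximize the infinite-horizon time-average expected reward; the policy may be randomized and history-dependent, and it may choose the initial states. The transition probabilities are called separable if $q^i_{kj}(t)=f^i_k(t)\,q^i(k,j)$ for all $i$, $k\neq j$, $t$, with $f^i_k(t)\in[0,1]$, $q^i(k,j)\ge 0$, $\sum_{j\ne k}q^i(k,j)\le 1$. Whittle's LP for such a bandit is $$\max \sum_{i=1}^n\sum_{k}\sum_{t\ge1} r^i_k x^i_{kt}\quad\text{subject to}\quad \sum_{i=1}^n\sum_k\sum_{t\ge 1} x^i_{kt}\le 1,\qquad \sum_k\sum_{t\ge1} t\,x^i_{kt}\le 1\ \ \forall i,$$ $$\sum_{j\ne k}\sum_{t\ge1} x^i_{kt}\,q^i_{kj}(t)=\sum_{j\neq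 k}\sum_{t\ge 1}x^i_{jt}\,q^i_{jk}(t)\ \ \forall i,k,\qquad x^i_{kt}\ge 0\ \ \forall i,k,t.$$ Theorem. If separability is not required, Whittle's LP has an $\Omega(n)$ gap even with $K=3$ states per arm. Precisely, there are constants $c,C>0$ such that for every $n\ge1$ there is a bandit as above with $n$ arms and $3$ states per arm, whose transition probabilities are non-decreasing in $t$ but not separable, in which every arm has an absorbing state of reward $0$, and such that 1. the optimal value $\mathrm{LP}$ of Whittle's LP satisfies $c\le \mathrm{LP}\le C$; 2. every policy, from every initial state, has time-average expected reward (limit superior) at most $1/n$; 3. hence, with $\mathrm{OPT}$ the supremum of the time-average expected rewards over all policies and initial states, $\mathrm{LP}\ge c\,n\cdot \mathrm{OPT}$. -/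

import Mathlib

/-- A bandit with `n` arms and `K` states per arm whose transition probabilities are monotone in the
time since the last play. `q i k j t` (for `j ≠ k`) is the probability that arm `i`, in state `k` and
played `t ≥ 1` steps after its previous play, moves to state `j`; with the remaining probability it
stays in `k`. The values `q i k k t` carry no information. -/
structure MonotoneTransitionBandit (n K : ℕ) where
  reward : Fin n → Fin K → ℝ
  q : Fin n → Fin K → Fin K → ℕ+ → ℝ
  reward_nonneg : ∀ i k, 0 ≤ reward i k
  q_nonneg : ∀ i k j t, j ≠ k → 0 ≤ q i k j t
  q_sum_le_one : ∀ i k t, ∑ j ∈ Finset.univ.erase k, q i k j t ≤ 1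
  q_monotone : ∀ i k j, j ≠ k → Monotone (q i k j)

namespace MonotoneTransitionBandit

variable {n K : ℕ}

/-- Separability: the transition probabilities are of the form `f_k(t) q(k, j)`, with an escape
probability `f_k(t) ∈ [0, 1]` and a sub-probability vector `q(k, ·)` on the states other than `k`. -/
def Separable (B : MonotoneTransitionBandit n K) : Prop :=
  ∃ (f : Fin n → Fin K → ℕ+ → ℝ) (w : Fin n → Fin K → Fin K → ℝ),
    (∀ i k t, 0 ≤ f i k t ∧ f i k t ≤ 1) ∧
    (∀ i k j, j ≠ k → 0 ≤ w i k j) ∧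
    (∀ i k, ∑ j ∈ Finset.univ.erase k, w i k j ≤ 1) ∧
    ∀ i k j t, j ≠ k → B.q i k j t = f i k t * w i k j

/-- State `a` of arm `i` is never left. -/
def IsAbsorbing (B : MonotoneTransitionBandit n K) (i : Fin n) (a : Fin K) : Prop :=
  ∀ j t, j ≠ a → B.q i a j t = 0

/-! ### Whittle's linear program -/

/-- Feasibility for Whittle's LP. The variable `x i k t` stands for the rate at which arm `i` is
played in state `k`, `t` steps after its previous play. -/
structure WhittleFeasible (B : MonotoneTransitionBandit n K) (x : Fin n → Fin K → ℕ+ → ℝ) : Prop where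
  nonneg : ∀ i k t, 0 ≤ x i k t
  summable : ∀ i k, Summable fun t : ℕ+ => (t : ℝ) * x i k t
  one_play : ∑ i, ∑ k, ∑' t : ℕ+, x i k t ≤ 1
  one_state : ∀ i, ∑ k, ∑' t : ℕ+, (t : ℝ) * x i k t ≤ 1
  balance : ∀ i k,
    ∑ j ∈ Finset.univ.erase k, ∑' t : ℕ+, x i k t * B.q i k j t =
      ∑ j ∈ Finset.univ.erase k, ∑' t : ℕ+, x i j t * B.q i j k t

/-- The objective of Whittle's LP. -/
noncomputable def whittleObjective (B : MonotoneTransitionBandit n K)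
    (x : Fin n → Fin K → ℕ+ → ℝ) : ℝ :=
  ∑ i, ∑ k, ∑' t : ℕ+, B.reward i k * x i k t

/-- The optimal value of Whittle's LP. -/
noncomputable def whittleValue (B : MonotoneTransitionBandit n K) : EReal :=
  ⨆ (x : Fin n → Fin K → ℕ+ → ℝ) (_ : B.WhittleFeasible x), (B.whittleObjective x : EReal)

/-! ### Policies and their time-average reward -/

/-- A joint state: for every arm its state and the number of steps since its last play. -/
abbrev JointState (n K : ℕ) := Fin n → Fin K × ℕ+

/-- A randomized history-dependent policy: from the past (joint states and actions, most recent
first) and the current joint state, it gives the law of the next action, which is to play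
arm `i` (`some i`) or no arm (`none`). -/
abbrev Policy (n K : ℕ) :=
  List (JointState n K × Option (Fin n)) → JointState n K → PMF (Option (Fin n))

/-- The probability that arm `i`, played in state `k` after `t` steps, is next in state `j`. -/
noncomputable def stepProb (B : MonotoneTransitionBandit n K) (i : Fin n) (k : Fin K) (t : ℕ+)
    (j : Fin K) : ℝ :=
  if j = k then 1 - ∑ l ∈ Finset.univ.erase k, B.q i k l t else B.q i k j t

/-- The next joint state if no arm is played. -/
def afterIdle (s : JointState n K) : JointState n K := fun i => ((s i).1, (s i).2 + 1)

/-- The next joint state if arm `i` is played and is then in state `j`. -/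
def afterPlay (s : JointState n K) (i : Fin n) (j : Fin K) : JointState n K :=
  Function.update (afterIdle s) i (j, 1)

/-- The expected total reward of the policy `π` in the next `T` steps, given the past `h` and the
current joint state `s`. -/
noncomputable def expReward (B : MonotoneTransitionBandit n K) (π : Policy n K) :
    ℕ → List (JointState n K × Option (Fin n)) → JointState n K → ℝ
  | 0, _, _ => 0
  | T + 1, h, s =>
      (π h s none).toReal * expReward B π T ((s, none) :: h) (afterIdle s) +
      ∑ i, (π h s (some i)).toReal *
        (B.reward i (s i).1 +
          ∑ j, B.stepProb i (s i).1 (s i).2 j *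
            expReward B π T ((s, some i) :: h) (afterPlay s i j))

/-- The infinite-horizon time-average expected reward (limit superior) of `π` started in `s`. -/
noncomputable def averageReward (B : MonotoneTransitionBandit n K) (π : Policy n K)
    (s : JointState n K) : EReal :=
  Filter.limsup (fun T : ℕ => ((B.expReward π T [] s / (T : ℝ) : ℝ) : EReal)) Filter.atTop

/-- The optimal time-average reward, over all policies and all initial joint states. -/
noncomputable def optimalReward (B : MonotoneTransitionBandit n K) : EReal :=
  ⨆ (π : Policy n K) (s : JointState n K), B.averageReward π s

end MonotoneTransitionBandit

/-!
Every arm has a rewarding state, to be played in every step, a waiting state, to be played every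
`n` steps, and an absorbing state. A play that comes too late absorbs the arm with probability
`1 - 1 / L`, where `L = 2 n²`, and a play on time exchanges the two live states with the small
probability `1 / L`. The LP can play every arm at rate `1 / (2 n)` in both live states, since this
takes only the fraction `(n + 1) / (2 n)` of the time of each arm; it collects `1 / 2`.

A policy collects reward in runs of plays of one arm in the rewarding state, and a run begins with
probability `1 / L` only. Any other arm that waits misses its deadline within `n` steps of a run, so
if no arm is to be lost, a run is worth at most `n` while other arms are waiting, which contributes
at most `n / L ≤ 1 / n` per step. The last surviving arm has runs of mean length `L`, but it gets
the chance of a run only once every `n` steps, which again yields `1 / n` per step. The expected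
number of losses is bounded, so they are negligible. All of this is expressed by one nonnegative
potential: the expected reward of a step plus the expected change of the potential never exceeds
`1 / n`.
-/

namespace MonotoneTransitionBandit

variable {n K : ℕ} (B : MonotoneTransitionBandit n K)

lemma stepProb_nonneg (i : Fin n) (k : Fin K) (t : ℕ+) (j : Fin K) : 0 ≤ B.stepProb i k t j := by
  unfold stepProb
  split_ifs with h
  · exact sub_nonneg.2 (B.q_sum_le_one i k t)
  · exact B.q_nonneg i k j t h

lemma sum_stepProb_mul (i : Fin n) (k : Fin K) (t : ℕ+) (f : Fin K → ℝ) :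
    ∑ j, B.stepProb i k t j * f j = f k + ∑ j, B.q i k j t * (f j - f k) := by
  have hmove : ∑ j ∈ Finset.univ.erase k, B.stepProb i k t j * f j =
      ∑ j ∈ Finset.univ.erase k, B.q i k j t * f j :=
    Finset.sum_congr rfl fun j hj => by rw [stepProb, if_neg (Finset.ne_of_mem_erase hj)]
  have hdiag : ∑ j, B.q i k j t * (f j - f k) =
      ∑ j ∈ Finset.univ.erase k, B.q i k j t * (f j - f k) :=
    (Finset.sum_erase _ (by simp)).symm
  rw [← Finset.add_sum_erase _ _ (Finset.mem_univ k), hmove, hdiag, stepProb, if_pos rfl]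
  simp only [mul_sub, Finset.sum_sub_distrib, ← Finset.sum_mul]
  ring

lemma sum_stepProb (i : Fin n) (k : Fin K) (t : ℕ+) : ∑ j, B.stepProb i k t j = 1 := by
  simpa using B.sum_stepProb_mul i k t fun _ => 1

/-- The expected reward collected in the joint state `s` by taking the action `a`. -/
def actionReward (s : JointState n K) (a : Option (Fin n)) : ℝ :=
  a.elim 0 fun i => B.reward i (s i).1

/-- The expectation of `Φ` at the joint state reached from `s` by taking the action `a`. -/
noncomputable def expNext (s : JointState n K) (a : Option (Fin n)) (Φ : JointState n K → ℝ) : ℝ :=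
  a.elim (Φ (afterIdle s)) fun i => ∑ j, B.stepProb i (s i).1 (s i).2 j * Φ (afterPlay s i j)

/-- The expected one-step change of the potential `Φ` together with the reward of the step. -/
noncomputable def drift (Φ : JointState n K → ℝ) (s : JointState n K) (a : Option (Fin n)) : ℝ :=
  B.actionReward s a + B.expNext s a Φ - Φ s

@[simp]
lemma actionReward_none (s : JointState n K) : B.actionReward s none = 0 := rfl

@[simp]
lemma actionReward_some (s : JointState n K) (i : Fin n) :
    B.actionReward s (some i) = B.reward i (s i).1 := rfl

@[simp]
lemma expNext_none (s : JointState n K) (Φ : JointState n K → ℝ) :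
    B.expNext s none Φ = Φ (afterIdle s) := rfl

@[simp]
lemma expNext_some (s : JointState n K) (i : Fin n) (Φ : JointState n K → ℝ) :
    B.expNext s (some i) Φ =
      ∑ j, B.stepProb i (s i).1 (s i).2 j * Φ (afterPlay s i j) := rfl

lemma drift_none (Φ : JointState n K → ℝ) (s : JointState n K) :
    B.drift Φ s none = Φ (afterIdle s) - Φ s := by
  rw [drift, actionReward_none, expNext_none, zero_add]

lemma drift_some (Φ : JointState n K → ℝ) (s : JointState n K) (i : Fin n) :
    B.drift Φ s (some i) =
      B.reward i (s i).1 + ∑ j, B.stepProb i (s i).1 (s i).2 j * Φ (afterPlay s i j) - Φ s := rfl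

lemma expNext_mono (s : JointState n K) (a : Option (Fin n)) : Monotone (B.expNext s a) := by
  intro Φ Ψ h
  cases a with
  | none => exact h _
  | some i =>
    rw [expNext_some, expNext_some]
    exact Finset.sum_le_sum fun j _ =>
      mul_le_mul_of_nonneg_left (h _) (B.stepProb_nonneg _ _ _ _)

lemma expNext_add (s : JointState n K) (a : Option (Fin n)) (Φ Ψ : JointState n K → ℝ) :
    B.expNext s a (fun s' => Φ s' + Ψ s') = B.expNext s a Φ + B.expNext s a Ψ := by
  cases a with
  | none => rfl
  | some i => simp only [expNext_some, mul_add, Finset.sum_add_distrib]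

lemma expNext_const (s : JointState n K) (a : Option (Fin n)) (c : ℝ) :
    B.expNext s a (fun _ => c) = c := by
  cases a with
  | none => rfl
  | some i => rw [expNext_some, ← Finset.sum_mul, sum_stepProb, one_mul]

lemma expNext_sum {ι : Type*} (S : Finset ι) (s : JointState n K) (a : Option (Fin n))
    (Φ : ι → JointState n K → ℝ) :
    B.expNext s a (fun s' => ∑ l ∈ S, Φ l s') = ∑ l ∈ S, B.expNext s a (Φ l) := by
  cases a with
  | none => rfl
  | some i =>
    simp only [expNext_some, Finset.mul_sum]
    exact Finset.sum_comm

lemma expNext_comp_apply_self (s : JointState n K) (i : Fin n) (f : Fin K × ℕ+ → ℝ) :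
    B.expNext s (some i) (fun s' => f (s' i)) =
      ∑ j, B.stepProb i (s i).1 (s i).2 j * f (j, 1) := by
  simp only [expNext_some, afterPlay, Function.update_self]

lemma expNext_comp_apply_of_ne (s : JointState n K) {a : Option (Fin n)} {l : Fin n}
    (h : a ≠ some l) (f : Fin K × ℕ+ → ℝ) :
    B.expNext s a (fun s' => f (s' l)) = f ((s l).1, (s l).2 + 1) := by
  cases a with
  | none => rfl
  | some i =>
    have hl : l ≠ i := fun hli => h (congrArg some hli.symm)
    simp only [expNext_some, afterPlay, Function.update_of_ne hl]
    rw [← Finset.sum_mul, sum_stepProb, one_mul, afterIdle]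

lemma expReward_succ (π : Policy n K) (T : ℕ) (h : List (JointState n K × Option (Fin n)))
    (s : JointState n K) :
    B.expReward π (T + 1) h s = ∑ a, (π h s a).toReal *
      (B.actionReward s a + B.expNext s a (B.expReward π T ((s, a) :: h))) := by
  simp [expReward, Fintype.sum_option]

lemma sum_toReal_mul_le {α : Type*} [Fintype α] (μ : PMF α) {f : α → ℝ} {c : ℝ}
    (h : ∀ a, f a ≤ c) : ∑ a, (μ a).toReal * f a ≤ c := by
  have hsum : ∑ a, (μ a).toReal = 1 := by
    rw [← ENNReal.toReal_sum fun a _ => μ.apply_ne_top a,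
      (tsum_fintype μ).symm.trans μ.tsum_coe, ENNReal.toReal_one]
  calc ∑ a, (μ a).toReal * f a ≤ ∑ a, (μ a).toReal * c :=
        Finset.sum_le_sum fun a _ => mul_le_mul_of_nonneg_left (h a) ENNReal.toReal_nonneg
    _ = c := by rw [← Finset.sum_mul, hsum, one_mul]

theorem expReward_le_of_potential {Φ : JointState n K → ℝ} {g : ℝ} (hΦ : ∀ s, 0 ≤ Φ s)
    (hdrift : ∀ s a, B.drift Φ s a ≤ g) (π : Policy n K) (T : ℕ)
    (h : List (JointState n K × Option (Fin n))) (s : JointState n K) :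
    B.expReward π T h s ≤ Φ s + T * g := by
  induction T generalizing h s with
  | zero => simpa [expReward] using hΦ s
  | succ T ih =>
    rw [expReward_succ]
    refine sum_toReal_mul_le _ fun a => ?_
    calc B.actionReward s a + B.expNext s a (B.expReward π T ((s, a) :: h))
        ≤ B.actionReward s a + B.expNext s a (fun s' => Φ s' + T * g) := by
          gcongr
          exact B.expNext_mono s a (ih _)
      _ = B.actionReward s a + B.expNext s a Φ + T * g := by
          rw [expNext_add, expNext_const, add_assoc]
      _ ≤ Φ s + g + T * g := add_le_add_left (sub_le_iff_le_add'.1 (hdrift s a)) _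
      _ = Φ s + (T + 1 : ℕ) * g := by push_cast; ring

theorem averageReward_le_of_expReward_le {π : Policy n K} {s : JointState n K} {a g : ℝ}
    (h : ∀ T : ℕ, B.expReward π T [] s ≤ a + T * g) : B.averageReward π s ≤ (g : EReal) := by
  have hlim : Filter.Tendsto (fun T : ℕ => ((a / (T : ℝ) + g : ℝ) : EReal)) Filter.atTop
      (nhds (g : EReal)) := by
    refine (continuous_coe_real_ereal.tendsto g).comp ?_
    simpa using (tendsto_const_div_atTop_nhds_zero_nat a).add_const g
  rw [averageReward, ← hlim.limsup_eq]
  refine Filter.limsup_le_limsup ?_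
  filter_upwards [Filter.eventually_gt_atTop 0] with T hT
  have hT' : (0 : ℝ) < T := Nat.cast_pos.2 hT
  rw [EReal.coe_le_coe_iff, div_le_iff₀ hT', add_mul, div_mul_cancel₀ _ hT'.ne', mul_comm g]
  exact h T

theorem optimalReward_le_of_potential {Φ : JointState n K → ℝ} {g : ℝ} (hΦ : ∀ s, 0 ≤ Φ s)
    (hdrift : ∀ s a, B.drift Φ s a ≤ g) :
    B.optimalReward ≤ (g : EReal) :=
  iSup₂_le fun π s => B.averageReward_le_of_expReward_le fun T =>
    B.expReward_le_of_potential hΦ hdrift π T [] s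

lemma averageReward_le_optimalReward (π : Policy n K) (s : JointState n K) :
    B.averageReward π s ≤ B.optimalReward :=
  le_iSup₂ (f := fun π s => B.averageReward π s) π s

lemma WhittleFeasible.summable_apply {B : MonotoneTransitionBandit n K}
    {x : Fin n → Fin K → ℕ+ → ℝ} (hx : B.WhittleFeasible x) (i : Fin n) (k : Fin K) :
    Summable (x i k) :=
  (hx.summable i k).of_nonneg_of_le (hx.nonneg i k) fun t =>
    le_mul_of_one_le_left (hx.nonneg i k t) (Nat.one_le_cast.2 t.pos)

theorem whittleValue_le_of_reward_le {C : ℝ} (hC : 0 ≤ C) (hr : ∀ i k, B.reward i k ≤ C) :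
    B.whittleValue ≤ (C : EReal) := by
  refine iSup₂_le fun x hx => EReal.coe_le_coe_iff.2 ?_
  calc B.whittleObjective x ≤ ∑ i, ∑ k, ∑' t : ℕ+, C * x i k t := by
        refine Finset.sum_le_sum fun i _ => Finset.sum_le_sum fun k _ => ?_
        exact Summable.tsum_le_tsum (fun t => mul_le_mul_of_nonneg_right (hr i k) (hx.nonneg i k t))
          ((hx.summable_apply i k).mul_left _) ((hx.summable_apply i k).mul_left _)
    _ = C * ∑ i, ∑ k, ∑' t : ℕ+, x i k t := by simp only [tsum_mul_left, Finset.mul_sum]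
    _ ≤ C := mul_le_of_le_one_right hC hx.one_play

/-! ### The three-state instance -/

/-- The mean length of a stay in the rewarding state of `gapBandit`. It is quadratic in `d` so that
a visit to that state that can last only `d` steps, begun with probability `1 / stayLength d`, is
worth at most `1 / d`. -/
noncomputable def stayLength (d : ℕ+) : ℝ := 2 * (d : ℝ) ^ 2

/-- The only time since the last play at which an arm of `gapBandit` in the given state should be
played: an earlier play leaves it in its state, a later one may move it to the absorbing state. -/
def deadline (d : ℕ+) : Fin 3 → ℕ := ![1, d, 0]

/-- The transition probabilities of an arm of `gapBandit`. -/
noncomputable def gapTransition (d : ℕ+) (k j : Fin 3) (t : ℕ+) : ℝ :=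
  if k = 2 then 0
  else if j = 2 then if (t : ℕ) ≤ deadline d k then 0 else 1 - (stayLength d)⁻¹
  else if deadline d k ≤ t then (stayLength d)⁻¹ else 0

section Parameters

variable (d : ℕ+)

lemma le_stayLength : (d : ℝ) ≤ stayLength d := by
  have hd : (1 : ℝ) ≤ d := Nat.one_le_cast.2 d.pos
  unfold stayLength
  nlinarith

lemma two_le_stayLength : 2 ≤ stayLength d := by
  have hd : (1 : ℝ) ≤ d := Nat.one_le_cast.2 d.pos
  unfold stayLength
  nlinarith

lemma stayLength_pos : 0 < stayLength d := two_pos.trans_le (two_le_stayLength d)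

lemma inv_stayLength_le_half : (stayLength d)⁻¹ ≤ 1 / 2 := by
  rw [one_div]
  exact inv_anti₀ two_pos (two_le_stayLength d)

lemma inv_stayLength_mul_le : (stayLength d)⁻¹ * d ≤ 1 / d := by
  have hd : (0 : ℝ) < d := Nat.cast_pos.2 d.pos
  unfold stayLength
  field_simp
  norm_num

end Parameters

/-- Identical arms with a rewarding state `0`, to be played in every step, a waiting state `1`, to
be played every `d` steps, and an absorbing state `2`. -/
noncomputable def gapBandit (n : ℕ) (d : ℕ+) : MonotoneTransitionBandit n 3 where
  reward _ k := if k = 0 then 1 else 0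
  q _ := gapTransition d
  reward_nonneg _ k := by split_ifs <;> norm_num
  q_nonneg _ k j t _ := by
    have hp := inv_pos.2 (stayLength_pos d)
    have hp' := inv_stayLength_le_half d
    unfold gapTransition
    split_ifs <;> linarith
  q_sum_le_one _ k t := by
    have hp := inv_pos.2 (stayLength_pos d)
    have hp' := inv_stayLength_le_half d
    rw [Finset.sum_erase_eq_sub (Finset.mem_univ k), Fin.sum_univ_three]
    unfold gapTransition
    fin_cases k
    · simp only [Fin.zero_eta, Fin.reduceEq, reduceIte]
      split_ifs <;> linarith
    · simp only [Fin.mk_one, Fin.reduceEq, reduceIte]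
      split_ifs <;> linarith
    · simp
  q_monotone _ k j _ t u htu := by
    have hp := inv_pos.2 (stayLength_pos d)
    have hp' := inv_stayLength_le_half d
    have htu' : (t : ℕ) ≤ u := htu
    unfold gapTransition
    split_ifs <;> linarith

variable {d : ℕ+}

lemma gapBandit_reward_le_one (i : Fin n) (k : Fin 3) : (gapBandit n d).reward i k ≤ 1 := by
  simp only [gapBandit]
  split_ifs <;> norm_num

lemma gapBandit_reward_of_ne_zero (i : Fin n) {k : Fin 3} (hk : k ≠ 0) :
    (gapBandit n d).reward i k = 0 := if_neg hk

lemma gapBandit_actionReward_le_one (s : JointState n 3) (a : Option (Fin n)) :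
    (gapBandit n d).actionReward s a ≤ 1 := by
  cases a with
  | none => exact zero_le_one
  | some i => exact gapBandit_reward_le_one i _

lemma gapBandit_isAbsorbing_two (i : Fin n) : (gapBandit n d).IsAbsorbing i 2 :=
  fun _ _ _ => by simp [gapBandit, gapTransition]

lemma gapBandit_not_separable (i : Fin n) : ¬ (gapBandit n d).Separable := by
  rintro ⟨f, w, -, -, -, h⟩
  have hp := inv_pos.2 (stayLength_pos d)
  have hp' := inv_stayLength_le_half d
  have hon_time : (stayLength d)⁻¹ = f i 1 d * w i 1 0 := by
    simpa [gapBandit, gapTransition, deadline] using h i 1 0 d (by decide)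
  have hon_time' : f i 1 d = 0 ∨ w i 1 2 = 0 := by
    simpa [gapBandit, gapTransition, deadline] using h i 1 2 d (by decide)
  have hlate : 1 - (stayLength d)⁻¹ = f i 1 (d + 1) * w i 1 2 := by
    simpa [gapBandit, gapTransition, deadline] using h i 1 2 (d + 1) (by decide)
  rcases hon_time' with hf | hw
  · rw [hf, zero_mul] at hon_time
    linarith
  · rw [hw, mul_zero] at hlate
    linarith

/-- The point of Whittle's LP that plays every arm of `gapBandit` on time, at rate `ρ` in each of
the states `0` and `1`. -/
noncomputable def onTimePoint (n : ℕ) (d : ℕ+) (ρ : ℝ) (_ : Fin n) (k : Fin 3) : ℕ+ → ℝ :=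
  ![Pi.single 1 ρ, Pi.single d ρ, 0] k

lemma tsum_onTimePoint_mul (ρ : ℝ) (i : Fin n) (k : Fin 3) (f : ℕ+ → ℝ) :
    ∑' t, onTimePoint n d ρ i k t * f t = ![ρ * f 1, ρ * f d, 0] k := by
  have hsingle (u : ℕ+) : ∑' t, (Pi.single u ρ : ℕ+ → ℝ) t * f t = ρ * f u := by
    simpa only [Pi.single_mul_left_apply] using tsum_pi_single u (ρ * f u)
  fin_cases k
  · exact hsingle 1
  · exact hsingle d
  · simp [onTimePoint]

lemma tsum_onTimePoint (ρ : ℝ) (i : Fin n) (k : Fin 3) :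
    ∑' t, onTimePoint n d ρ i k t = ![ρ, ρ, 0] k := by
  simpa using tsum_onTimePoint_mul ρ i k fun _ => 1

lemma onTimePoint_feasible {ρ : ℝ} (hρ : 0 ≤ ρ) (hplay : n * (2 * ρ) ≤ 1)
    (hstate : (d + 1) * ρ ≤ 1) : (gapBandit n d).WhittleFeasible (onTimePoint n d ρ) where
  nonneg i k := by
    have hsingle (u : ℕ+) : (0 : ℕ+ → ℝ) ≤ Pi.single u ρ := Pi.single_nonneg.2 hρ
    fin_cases k
    · exact hsingle 1
    · exact hsingle d
    · exact fun _ => le_rfl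
  summable i k := by
    refine summable_of_ne_finset_zero (s := {1, d}) fun t ht => ?_
    simp only [Finset.mem_insert, Finset.mem_singleton, not_or] at ht
    fin_cases k <;> simp [onTimePoint, ht.1, ht.2]
  one_play := by
    simpa [tsum_onTimePoint, Fin.sum_univ_three, ← two_mul] using hplay
  one_state i := by
    simp only [mul_comm _ (onTimePoint n d ρ _ _ _), tsum_onTimePoint_mul, Fin.sum_univ_three,
      Matrix.cons_val, PNat.one_coe, Nat.cast_one]
    linarith
  balance i k := by
    simp only [tsum_onTimePoint_mul, Finset.sum_erase_eq_sub (Finset.mem_univ k),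
      Fin.sum_univ_three]
    fin_cases k <;> simp [gapBandit, gapTransition, deadline]

theorem le_whittleValue_gapBandit {ρ : ℝ} (hρ : 0 ≤ ρ) (hplay : n * (2 * ρ) ≤ 1)
    (hstate : (d + 1) * ρ ≤ 1) : ((n * ρ : ℝ) : EReal) ≤ (gapBandit n d).whittleValue := by
  refine le_iSup₂_of_le (onTimePoint n d ρ) (onTimePoint_feasible hρ hplay hstate) ?_
  simp [whittleObjective, tsum_onTimePoint, Fin.sum_univ_three, gapBandit]

/-- The number of steps within which an arm of `gapBandit` has to be played in order not to miss
its deadline; it is `0` if the deadline is missed, and in the absorbing state. -/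
def timeLeft (d : ℕ+) (a : Fin 3 × ℕ+) : ℕ := deadline d a.1 + 1 - a.2

lemma timeLeft_succ (k : Fin 3) (t : ℕ+) : timeLeft d (k, t + 1) = timeLeft d (k, t) - 1 := by
  simp only [timeLeft, PNat.add_coe, PNat.one_coe]
  omega

lemma timeLeft_running : timeLeft d (0, 1) = 1 := rfl

lemma timeLeft_absorbed (t : ℕ+) : timeLeft d (2, t) = 0 := by
  have := t.pos
  simp only [timeLeft, deadline, Matrix.cons_val]
  omega

lemma eq_running_of_timeLeft_ne_zero {t : ℕ+} (h : timeLeft d (0, t) ≠ 0) : t = 1 := by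
  have ht : (t : ℕ) ≤ 1 := by
    simp only [timeLeft, deadline, Matrix.cons_val] at h
    omega
  exact le_antisymm ht one_le

lemma eq_waiting_of_one_lt_timeLeft {k : Fin 3} {t : ℕ+} (h : 1 < timeLeft d (k, t)) : k = 1 := by
  have hlt : (1 : ℕ) < deadline d k := by
    have := t.pos
    simp only [timeLeft] at h
    omega
  fin_cases k <;> simp_all [deadline]

section StepProb

variable (i : Fin n) {k : Fin 3} {t : ℕ+} (f : Fin 3 → ℝ)

lemma sum_stepProb_mul_of_early (h : 1 < timeLeft d (k, t)) :
    ∑ j, (gapBandit n d).stepProb i k t j * f j = f k := by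
  have hlt : ¬ deadline d k ≤ t := by simp only [timeLeft] at h; omega
  have hle : (t : ℕ) ≤ deadline d k := by omega
  simp [sum_stepProb_mul, gapBandit, gapTransition, hlt, hle]

lemma sum_stepProb_mul_of_on_time (h : timeLeft d (k, t) = 1) :
    ∑ j, (gapBandit n d).stepProb i k t j * f j =
      (stayLength d)⁻¹ * f (1 - k) + (1 - (stayLength d)⁻¹) * f k := by
  have heq : deadline d k = t := by simp only [timeLeft] at h; omega
  have hk : k ≠ 2 := by rintro rfl; simp [timeLeft_absorbed] at h
  simp only [sum_stepProb_mul, Fin.sum_univ_three, gapBandit, gapTransition, heq, hk, le_refl]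
  fin_cases k
  · simp only [Fin.zero_eta, Fin.reduceEq, reduceIte, sub_zero]
    ring
  · simp only [Fin.mk_one, Fin.reduceEq, reduceIte, sub_self]
    ring
  · exact absurd rfl hk

lemma sum_stepProb_mul_of_late (hk : k ≠ 2) (h : timeLeft d (k, t) = 0) :
    ∑ j, (gapBandit n d).stepProb i k t j * f j =
      (stayLength d)⁻¹ * f (1 - k) + (1 - (stayLength d)⁻¹) * f 2 := by
  have hlt : ¬ (t : ℕ) ≤ deadline d k := by simp only [timeLeft] at h; omega
  have hle : deadline d k ≤ t := by omega
  simp only [sum_stepProb_mul, Fin.sum_univ_three, gapBandit, gapTransition, hlt, hle, hk]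
  fin_cases k
  · simp only [Fin.zero_eta, Fin.reduceEq, reduceIte, sub_zero]
    ring
  · simp only [Fin.mk_one, Fin.reduceEq, reduceIte, sub_self]
    ring
  · exact absurd rfl hk

lemma sum_stepProb_mul_of_absorbed :
    ∑ j, (gapBandit n d).stepProb i 2 t j * f j = f 2 := by
  simp [sum_stepProb_mul, gapBandit, gapTransition]

end StepProb

/-! ### The potential of the instance -/

/-- The value of an arm in the potential of `gapBandit`. Missing a deadline costs
`stayLength d + 1`, which pays for the reward of the step and for any increase of `coupling`. The
value `5` of an arm that has missed its deadline covers the chance that it recovers. -/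
noncomputable def armValue (d : ℕ+) (a : Fin 3 × ℕ+) : ℝ :=
  if timeLeft d a ≠ 0 then stayLength d + 6 else if a.1 = 2 then 0 else 5

lemma armValue_of_timeLeft_ne_zero {a : Fin 3 × ℕ+} (h : timeLeft d a ≠ 0) :
    armValue d a = stayLength d + 6 := if_pos h

lemma armValue_absorbed (t : ℕ+) : armValue d (2, t) = 0 := by simp [armValue, timeLeft_absorbed]

lemma armValue_of_missed {k : Fin 3} {t : ℕ+} (hk : k ≠ 2) (h : timeLeft d (k, t) = 0) :
    armValue d (k, t) = 5 := by simp [armValue, h, hk]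

lemma armValue_just_played {k : Fin 3} (hk : k ≠ 2) : armValue d (k, 1) = stayLength d + 6 := by
  refine armValue_of_timeLeft_ne_zero ?_
  have := d.pos
  fin_cases k <;> simp_all [timeLeft, deadline]

lemma one_sub_ne_two {k : Fin 3} (hk : k ≠ 2) : 1 - k ≠ 2 := by
  revert k
  decide

lemma armValue_nonneg (a : Fin 3 × ℕ+) : 0 ≤ armValue d a := by
  have := stayLength_pos d
  unfold armValue
  split_ifs <;> positivity

lemma armValue_succ_le (k : Fin 3) (t : ℕ+) : armValue d (k, t + 1) ≤ armValue d (k, t) := by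
  have := stayLength_pos d
  unfold armValue
  rw [timeLeft_succ]
  split_ifs <;> first | linarith | omega

lemma armValue_succ_add_le_of_missed {k : Fin 3} {t : ℕ+} (h : timeLeft d (k, t) = 1) :
    armValue d (k, t + 1) + (stayLength d + 1) ≤ armValue d (k, t) := by
  unfold armValue
  rw [timeLeft_succ, h]
  split_ifs <;> first | linarith | omega

lemma sum_stepProb_mul_armValue_of_timeLeft_ne_zero (i : Fin n) {k : Fin 3} {t : ℕ+}
    (h : timeLeft d (k, t) ≠ 0) :
    ∑ j, (gapBandit n d).stepProb i k t j * armValue d (j, 1) = armValue d (k, t) := by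
  have hk : k ≠ 2 := by rintro rfl; exact h (timeLeft_absorbed t)
  rw [armValue_of_timeLeft_ne_zero h]
  rcases lt_or_eq_of_le (Nat.one_le_iff_ne_zero.2 h) with hearly | hon_time
  · rw [sum_stepProb_mul_of_early i _ hearly, armValue_just_played hk]
  · have hk' := one_sub_ne_two hk
    rw [sum_stepProb_mul_of_on_time i _ hon_time.symm, armValue_just_played hk,
      armValue_just_played hk']
    ring

lemma sum_stepProb_mul_armValue_add_one_le_of_missed (i : Fin n) {k : Fin 3} {t : ℕ+} (hk : k ≠ 2)
    (h : timeLeft d (k, t) = 0) :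
    ∑ j, (gapBandit n d).stepProb i k t j * armValue d (j, 1) + 1 ≤ armValue d (k, t) := by
  have hk' := one_sub_ne_two hk
  have hp := inv_stayLength_le_half d
  have hpL := inv_mul_cancel₀ (stayLength_pos d).ne'
  rw [sum_stepProb_mul_of_late i _ hk h, armValue_just_played hk', armValue_absorbed,
    armValue_of_missed hk h]
  linarith

lemma sum_stepProb_mul_armValue_le (i : Fin n) (k : Fin 3) (t : ℕ+) :
    ∑ j, (gapBandit n d).stepProb i k t j * armValue d (j, 1) ≤ armValue d (k, t) := by
  by_cases h : timeLeft d (k, t) = 0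
  · rcases eq_or_ne k 2 with rfl | hk
    · rw [sum_stepProb_mul_of_absorbed, armValue_absorbed, armValue_absorbed]
    · linarith [sum_stepProb_mul_armValue_add_one_le_of_missed i hk h]
  · exact (sum_stepProb_mul_armValue_of_timeLeft_ne_zero i h).le

lemma expNext_armValue_le (s : JointState n 3) (a : Option (Fin n)) (l : Fin n) :
    (gapBandit n d).expNext s a (fun s' => armValue d (s' l)) ≤ armValue d (s l) := by
  by_cases hl : a = some l
  · rw [hl, expNext_comp_apply_self]
    exact sum_stepProb_mul_armValue_le l _ _
  · rw [expNext_comp_apply_of_ne _ _ hl]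
    exact armValue_succ_le _ _

lemma expNext_sum_armValue_le (s : JointState n 3) (a : Option (Fin n)) :
    (gapBandit n d).expNext s a (fun s' => ∑ l, armValue d (s' l)) ≤ ∑ l, armValue d (s l) := by
  rw [expNext_sum]
  exact Finset.sum_le_sum fun l _ => expNext_armValue_le s a l

lemma expNext_sum_armValue_add_le {s : JointState n 3} {a : Option (Fin n)} {l : Fin n} {c : ℝ}
    (h : (gapBandit n d).expNext s a (fun s' => armValue d (s' l)) + c ≤ armValue d (s l)) :
    (gapBandit n d).expNext s a (fun s' => ∑ l, armValue d (s' l)) + c ≤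
      ∑ l, armValue d (s l) := by
  rw [expNext_sum, ← Finset.add_sum_erase _ _ (Finset.mem_univ l),
    ← Finset.add_sum_erase _ (fun l => armValue d (s l)) (Finset.mem_univ l)]
  have hothers := Finset.sum_le_sum fun m (_ : m ∈ Finset.univ.erase l) =>
    expNext_armValue_le (d := d) s a m
  linarith

/-- Under the action `a` in the joint state `s`, some arm that is not played misses its deadline. -/
def MissesDeadline (d : ℕ+) (s : JointState n 3) (a : Option (Fin n)) : Prop :=
  ∃ l, a ≠ some l ∧ timeLeft d (s l) = 1

lemma MissesDeadline.expNext_sum_armValue_add_le {s : JointState n 3} {a : Option (Fin n)}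
    (h : MissesDeadline d s a) :
    (gapBandit n d).expNext s a (fun s' => ∑ l, armValue d (s' l)) + (stayLength d + 1) ≤
      ∑ l, armValue d (s l) := by
  obtain ⟨l, hl, htime⟩ := h
  refine MonotoneTransitionBandit.expNext_sum_armValue_add_le (l := l) ?_
  rw [expNext_comp_apply_of_ne _ _ hl]
  exact armValue_succ_add_le_of_missed htime

/-- Some arm is in the rewarding state and was just played. -/
def IsRunning (s : JointState n 3) : Prop := ∃ i, s i = (0, 1)

/-- The time left to an arm in the waiting state; `0` in the other states. -/
def waitLeft (d : ℕ+) (a : Fin 3 × ℕ+) : ℕ := if a.1 = 1 then timeLeft d a else 0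

/-- The longest time left to an arm in the waiting state; `0` if all of them have missed their
deadline. -/
def maxWaitLeft (d : ℕ+) (s : JointState n 3) : ℕ := Finset.univ.sup fun l => waitLeft d (s l)

open Classical in
/-- The part of the potential of `gapBandit` that depends on the interaction of the arms. A running
arm is worth a full stay if no other arm is waiting in time, and otherwise only the number of steps
until a waiting arm is lost. Without a running arm, the coupling grows by at most `1 / d` per step,
up to the value `1` of starting an uninterrupted stay with probability `1 / stayLength d`. -/
noncomputable def coupling (d : ℕ+) (s : JointState n 3) : ℝ :=
  if IsRunning s then if maxWaitLeft d s = 0 then stayLength d else maxWaitLeft d s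
  else 1 - (maxWaitLeft d s : ℝ) / d

lemma coupling_of_isRunning {s : JointState n 3} (h : IsRunning s) :
    coupling d s = if maxWaitLeft d s = 0 then stayLength d else (maxWaitLeft d s : ℝ) := if_pos h

lemma coupling_of_not_isRunning {s : JointState n 3} (h : ¬ IsRunning s) :
    coupling d s = 1 - (maxWaitLeft d s : ℝ) / d := if_neg h

lemma waitLeft_le (a : Fin 3 × ℕ+) : waitLeft d a ≤ d := by
  have := a.2.pos
  unfold waitLeft
  split_ifs with h
  · simp only [timeLeft, h, deadline, Matrix.cons_val]
    omega
  · exact Nat.zero_le _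

lemma waitLeft_succ (k : Fin 3) (t : ℕ+) : waitLeft d (k, t + 1) = waitLeft d (k, t) - 1 := by
  unfold waitLeft
  rw [timeLeft_succ]
  split_ifs <;> rfl

lemma waitLeft_le_timeLeft (a : Fin 3 × ℕ+) : waitLeft d a ≤ timeLeft d a := by
  unfold waitLeft
  split_ifs
  exacts [le_rfl, Nat.zero_le _]

lemma waitLeft_le_maxWaitLeft (s : JointState n 3) (l : Fin n) :
    waitLeft d (s l) ≤ maxWaitLeft d s :=
  Finset.le_sup (f := fun l => waitLeft d (s l)) (Finset.mem_univ l)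

lemma maxWaitLeft_le (s : JointState n 3) : maxWaitLeft d s ≤ d :=
  Finset.sup_le fun l _ => waitLeft_le (s l)

lemma afterPlay_self (s : JointState n K) (i : Fin n) (j : Fin K) : afterPlay s i j i = (j, 1) :=
  Function.update_self ..

lemma afterPlay_of_ne (s : JointState n K) {i l : Fin n} (h : l ≠ i) (j : Fin K) :
    afterPlay s i j l = ((s l).1, (s l).2 + 1) :=
  Function.update_of_ne h ..

lemma maxWaitLeft_le_afterIdle_add_one (s : JointState n 3) :
    maxWaitLeft d s ≤ maxWaitLeft d (afterIdle s) + 1 := by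
  refine Finset.sup_le fun l _ => Nat.sub_le_iff_le_add.1 ?_
  rw [← waitLeft_succ]
  exact waitLeft_le_maxWaitLeft (afterIdle s) l

lemma maxWaitLeft_le_afterPlay_add_one {s : JointState n 3} {i : Fin n}
    (h : waitLeft d (s i) ≤ 1) (j : Fin 3) :
    maxWaitLeft d s ≤ maxWaitLeft d (afterPlay s i j) + 1 := by
  refine Finset.sup_le fun l _ => ?_
  rcases eq_or_ne l i with rfl | hl
  · exact h.trans (Nat.le_add_left _ _)
  · refine Nat.sub_le_iff_le_add.1 ?_
    rw [← waitLeft_succ, ← afterPlay_of_ne s hl j]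
    exact waitLeft_le_maxWaitLeft _ l

lemma maxWaitLeft_afterPlay_one (s : JointState n 3) (i : Fin n) :
    maxWaitLeft d (afterPlay s i 1) = d := by
  refine le_antisymm (maxWaitLeft_le _) ?_
  have hi : waitLeft d (afterPlay s i 1 i) = d := by
    rw [afterPlay_self]
    rfl
  exact hi.ge.trans (waitLeft_le_maxWaitLeft _ i)

lemma maxWaitLeft_afterPlay_zero_le (s : JointState n 3) (i : Fin n) :
    maxWaitLeft d (afterPlay s i 0) ≤ maxWaitLeft d s - 1 := by
  refine Finset.sup_le fun l _ => ?_
  rcases eq_or_ne l i with rfl | hl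
  · rw [afterPlay_self]
    exact Nat.zero_le _
  · rw [afterPlay_of_ne s hl, waitLeft_succ]
    exact Nat.sub_le_sub_right (waitLeft_le_maxWaitLeft s l) 1

lemma maxWaitLeft_ne_one {s : JointState n 3} {i : Fin n} (hmiss : ¬ MissesDeadline d s (some i))
    (hi : waitLeft d (s i) = 0) : maxWaitLeft d s ≠ 1 := by
  intro hone
  obtain ⟨l, -, hl⟩ := Finset.exists_mem_eq_sup Finset.univ ⟨i, Finset.mem_univ i⟩
    fun l => waitLeft d (s l)
  have hwait : waitLeft d (s l) = 1 := hl.symm.trans hone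
  have hli : i ≠ l := by rintro rfl; omega
  have hstate : (s l).1 = 1 := by
    by_contra hne
    simp [waitLeft, hne] at hwait
  refine hmiss ⟨l, fun h => hli (Option.some_injective _ h), ?_⟩
  rwa [waitLeft, if_pos hstate] at hwait

lemma add_one_ne_one (t : ℕ+) : t + 1 ≠ 1 := (PNat.lt_add_left 1 t).ne'

lemma not_isRunning_afterIdle (s : JointState n 3) : ¬ IsRunning (afterIdle s) := by
  rintro ⟨l, hl⟩
  exact add_one_ne_one _ (congrArg Prod.snd hl)

lemma isRunning_afterPlay_iff (s : JointState n 3) (i : Fin n) (j : Fin 3) :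
    IsRunning (afterPlay s i j) ↔ j = 0 := by
  constructor
  · rintro ⟨l, hl⟩
    rcases eq_or_ne l i with rfl | hli
    · exact congrArg Prod.fst ((afterPlay_self s l j).symm.trans hl)
    · exact absurd (congrArg Prod.snd ((afterPlay_of_ne s hli j).symm.trans hl)) (add_one_ne_one _)
  · rintro rfl
    exact ⟨i, afterPlay_self s i 0⟩

lemma not_isRunning_of_not_missesDeadline {s : JointState n 3} {a : Option (Fin n)}
    (hmiss : ¬ MissesDeadline d s a) (ha : ∀ i, a = some i → s i ≠ (0, 1)) : ¬ IsRunning s := by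
  rintro ⟨l, hl⟩
  exact hmiss ⟨l, fun h => ha l h hl, by rw [hl, timeLeft_running]⟩

lemma coupling_nonneg (s : JointState n 3) : 0 ≤ coupling d s := by
  have hL := stayLength_pos d
  have hslack : (maxWaitLeft d s : ℝ) / d ≤ 1 :=
    div_le_one_of_le₀ (Nat.cast_le.2 (maxWaitLeft_le s)) (Nat.cast_nonneg _)
  unfold coupling
  split_ifs
  exacts [hL.le, Nat.cast_nonneg _, sub_nonneg.2 hslack]

lemma coupling_le_stayLength (s : JointState n 3) : coupling d s ≤ stayLength d := by
  have hslack : (maxWaitLeft d s : ℝ) ≤ d := Nat.cast_le.2 (maxWaitLeft_le s)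
  have hdiv : 0 ≤ (maxWaitLeft d s : ℝ) / d := by positivity
  unfold coupling
  split_ifs
  · exact le_rfl
  · exact hslack.trans (le_stayLength d)
  · linarith [two_le_stayLength d]

lemma coupling_le_add_of_not_isRunning {s s' : JointState n 3} (hs : ¬ IsRunning s)
    (hs' : ¬ IsRunning s') (h : maxWaitLeft d s ≤ maxWaitLeft d s' + 1) :
    coupling d s' ≤ coupling d s + 1 / d := by
  have hle : (maxWaitLeft d s : ℝ) ≤ maxWaitLeft d s' + 1 := by exact_mod_cast h
  have hdiv : (maxWaitLeft d s : ℝ) / d ≤ (maxWaitLeft d s' + 1) / d := by gcongr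
  rw [coupling_of_not_isRunning hs, coupling_of_not_isRunning hs']
  rw [add_div] at hdiv
  linarith

lemma coupling_afterPlay_one (s : JointState n 3) (i : Fin n) :
    coupling d (afterPlay s i 1) = 0 := by
  rw [coupling_of_not_isRunning (by simp [isRunning_afterPlay_iff]), maxWaitLeft_afterPlay_one,
    div_self (Nat.cast_ne_zero.2 d.ne_zero), sub_self]

lemma coupling_afterPlay_two_le {s : JointState n 3} {i : Fin n} (hs : ¬ IsRunning s)
    (hi : waitLeft d (s i) = 0) : coupling d (afterPlay s i 2) ≤ coupling d s + 1 / d :=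
  coupling_le_add_of_not_isRunning hs (by simp [isRunning_afterPlay_iff])
    (maxWaitLeft_le_afterPlay_add_one (hi.le.trans zero_le_one) 2)

lemma coupling_afterPlay_zero_of_running {s : JointState n 3} {i : Fin n} (hi : s i = (0, 1))
    (hmiss : ¬ MissesDeadline d s (some i)) :
    1 + (1 - (stayLength d)⁻¹) * coupling d (afterPlay s i 0) ≤ coupling d s := by
  have hwait : waitLeft d (s i) = 0 := by rw [hi]; rfl
  have hne := maxWaitLeft_ne_one hmiss hwait
  have hslack : maxWaitLeft d (afterPlay s i 0) = maxWaitLeft d s - 1 :=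
    le_antisymm (maxWaitLeft_afterPlay_zero_le s i) <|
      Nat.sub_le_iff_le_add.2 <| maxWaitLeft_le_afterPlay_add_one (hwait.le.trans zero_le_one) 0
  rw [coupling_of_isRunning ⟨i, hi⟩, coupling_of_isRunning ((isRunning_afterPlay_iff s i 0).2 rfl),
    hslack]
  rcases Nat.eq_zero_or_pos (maxWaitLeft d s) with hzero | hpos
  · rw [if_pos hzero, if_pos (by omega)]
    linarith [inv_mul_cancel₀ (stayLength_pos d).ne']
  · rw [if_neg hpos.ne', if_neg (by omega), Nat.cast_pred hpos]
    have hone : (1 : ℝ) ≤ maxWaitLeft d s := Nat.one_le_cast.2 hpos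
    nlinarith [inv_pos.2 (stayLength_pos d)]

lemma inv_stayLength_mul_coupling_le_one (s : JointState n 3) :
    (stayLength d)⁻¹ * coupling d s ≤ 1 := by
  rw [inv_mul_le_one₀ (stayLength_pos d)]
  exact coupling_le_stayLength s

lemma coupling_afterPlay_zero_of_waiting {s : JointState n 3} {i : Fin n} (hs : ¬ IsRunning s)
    (hi : waitLeft d (s i) ≤ 1) :
    (stayLength d)⁻¹ * coupling d (afterPlay s i 0) ≤ coupling d s + 1 / d := by
  have hslack := maxWaitLeft_le_afterPlay_add_one hi 0
  rcases Nat.eq_zero_or_pos (maxWaitLeft d (afterPlay s i 0)) with hzero | hpos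
  · refine (inv_stayLength_mul_coupling_le_one _).trans ?_
    have hle : (maxWaitLeft d s : ℝ) ≤ 1 := by exact_mod_cast hzero ▸ hslack
    have hdiv : (maxWaitLeft d s : ℝ) / d ≤ 1 / d := by gcongr
    rw [coupling_of_not_isRunning hs]
    linarith
  · rw [coupling_of_isRunning ((isRunning_afterPlay_iff s i 0).2 rfl), if_neg hpos.ne']
    have hle : (stayLength d)⁻¹ * maxWaitLeft d (afterPlay s i 0) ≤ (stayLength d)⁻¹ * d :=
      mul_le_mul_of_nonneg_left (Nat.cast_le.2 (maxWaitLeft_le _)) (inv_pos.2 (stayLength_pos d)).le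
    linarith [inv_stayLength_mul_le d, coupling_nonneg (d := d) s]

section Drift

variable {s : JointState n 3} {i : Fin n}

lemma drift_coupling_none_le (hmiss : ¬ MissesDeadline d s none) :
    (gapBandit n d).drift (coupling d) s none ≤ 1 / d := by
  rw [drift_none, sub_le_iff_le_add']
  have hs : ¬ IsRunning s := not_isRunning_of_not_missesDeadline hmiss (by simp)
  exact coupling_le_add_of_not_isRunning hs (not_isRunning_afterIdle s)
    (maxWaitLeft_le_afterIdle_add_one s)

lemma drift_coupling_le_of_absorbed (hmiss : ¬ MissesDeadline d s (some i)) (hi : (s i).1 = 2) :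
    (gapBandit n d).drift (coupling d) s (some i) ≤ 1 / d := by
  have hs : ¬ IsRunning s := not_isRunning_of_not_missesDeadline hmiss (by
    rintro _ ⟨⟩ h
    simp [h] at hi)
  rw [drift_some, sub_le_iff_le_add', hi, sum_stepProb_mul_of_absorbed,
    gapBandit_reward_of_ne_zero i (by decide), zero_add]
  exact coupling_afterPlay_two_le hs (by simp [waitLeft, hi])

lemma drift_coupling_le_of_early (h : 1 < timeLeft d (s i)) :
    (gapBandit n d).drift (coupling d) s (some i) ≤ 1 / d := by
  have hi : (s i).1 = 1 := eq_waiting_of_one_lt_timeLeft h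
  rw [drift_some, sub_le_iff_le_add', sum_stepProb_mul_of_early i _ h, hi,
    gapBandit_reward_of_ne_zero i (by decide), coupling_afterPlay_one, add_zero]
  have := coupling_nonneg (d := d) s
  positivity

lemma drift_coupling_le_of_running (hmiss : ¬ MissesDeadline d s (some i)) (hi : s i = (0, 1)) :
    (gapBandit n d).drift (coupling d) s (some i) ≤ 1 / d := by
  have hstay := coupling_afterPlay_zero_of_running hi hmiss
  have hd : 0 ≤ 1 / (d : ℝ) := by positivity
  rw [drift_some, sub_le_iff_le_add', hi, sum_stepProb_mul_of_on_time i _ timeLeft_running,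
    sub_zero, coupling_afterPlay_one, mul_zero, zero_add]
  exact (add_le_add_left (gapBandit_reward_le_one i 0) _).trans (by linarith)

lemma drift_coupling_le_of_waiting (hmiss : ¬ MissesDeadline d s (some i)) (hi : (s i).1 = 1)
    (h : timeLeft d (s i) = 1) :
    (gapBandit n d).drift (coupling d) s (some i) ≤ 1 / d := by
  have hs : ¬ IsRunning s := not_isRunning_of_not_missesDeadline hmiss (by
    rintro _ ⟨⟩ h
    simp [h] at hi)
  rw [drift_some, sub_le_iff_le_add', sum_stepProb_mul_of_on_time i _ h, hi, sub_self,
    gapBandit_reward_of_ne_zero i (by decide), coupling_afterPlay_one, mul_zero, add_zero, zero_add]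
  exact coupling_afterPlay_zero_of_waiting hs (h ▸ waitLeft_le_timeLeft _)

lemma drift_coupling_le_of_late (hmiss : ¬ MissesDeadline d s (some i)) (hi : (s i).1 ≠ 2)
    (h : timeLeft d (s i) = 0) :
    (gapBandit n d).drift (coupling d) s (some i) ≤ 1 / d + 1 := by
  have hs : ¬ IsRunning s := not_isRunning_of_not_missesDeadline hmiss (by
    rintro _ ⟨⟩ hrun
    simp [hrun, timeLeft_running] at h)
  have hwait : waitLeft d (s i) = 0 := Nat.le_zero.1 (h ▸ waitLeft_le_timeLeft _)
  have habsorbed : (1 - (stayLength d)⁻¹) * coupling d (afterPlay s i 2) ≤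
      coupling d s + 1 / d :=
    (mul_le_of_le_one_left (coupling_nonneg _)
      (sub_le_self _ (inv_pos.2 (stayLength_pos d)).le)).trans (coupling_afterPlay_two_le hs hwait)
  have hswitch : (gapBandit n d).reward i (s i).1 +
      (stayLength d)⁻¹ * coupling d (afterPlay s i (1 - (s i).1)) ≤ 1 := by
    by_cases hzero : (s i).1 = 0
    · rw [hzero, sub_zero, coupling_afterPlay_one, mul_zero, add_zero]
      exact gapBandit_reward_le_one i 0
    · rw [gapBandit_reward_of_ne_zero i hzero, zero_add]
      exact inv_stayLength_mul_coupling_le_one _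
  rw [drift_some, sub_le_iff_le_add', sum_stepProb_mul_of_late i _ hi h]
  linarith

lemma drift_coupling_le_of_not_late {a : Option (Fin n)} (hmiss : ¬ MissesDeadline d s a)
    (hlate : ∀ i, a = some i → (s i).1 ≠ 2 → timeLeft d (s i) ≠ 0) :
    (gapBandit n d).drift (coupling d) s a ≤ 1 / d := by
  cases a with
  | none => exact drift_coupling_none_le hmiss
  | some i =>
    by_cases habsorbed : (s i).1 = 2
    · exact drift_coupling_le_of_absorbed hmiss habsorbed
    have htime := hlate i rfl habsorbed
    rcases (Nat.one_le_iff_ne_zero.2 htime).lt_or_eq with hearly | hon_time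
    · exact drift_coupling_le_of_early hearly
    by_cases hzero : (s i).1 = 0
    · refine drift_coupling_le_of_running hmiss (Prod.ext hzero ?_)
      exact eq_running_of_timeLeft_ne_zero (by rwa [← hzero])
    · exact drift_coupling_le_of_waiting hmiss (by omega) hon_time.symm

lemma drift_coupling_le (s : JointState n 3) (a : Option (Fin n)) :
    (gapBandit n d).drift (coupling d) s a ≤ stayLength d + 1 := by
  have hcoupling := (gapBandit n d).expNext_mono s a (coupling_le_stayLength (d := d))
  rw [expNext_const] at hcoupling
  rw [drift]
  linarith [gapBandit_actionReward_le_one (d := d) s a, coupling_nonneg (d := d) s]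

end Drift

/-- The potential of `gapBandit`, an upper bound up to `T / d` for the expected reward of the next
`T` steps. -/
noncomputable def gapPotential (d : ℕ+) (s : JointState n 3) : ℝ :=
  ∑ l, armValue d (s l) + coupling d s

lemma gapPotential_nonneg (s : JointState n 3) : 0 ≤ gapPotential d s :=
  add_nonneg (Finset.sum_nonneg fun l _ => armValue_nonneg (s l)) (coupling_nonneg s)

lemma drift_gapPotential (s : JointState n 3) (a : Option (Fin n)) :
    (gapBandit n d).drift (gapPotential d) s a =
      ((gapBandit n d).expNext s a (fun s' => ∑ l, armValue d (s' l)) - ∑ l, armValue d (s l)) +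
        (gapBandit n d).drift (coupling d) s a := by
  unfold gapPotential drift
  rw [expNext_add]
  ring

theorem drift_gapPotential_le (s : JointState n 3) (a : Option (Fin n)) :
    (gapBandit n d).drift (gapPotential d) s a ≤ 1 / d := by
  rw [drift_gapPotential]
  by_cases hmiss : MissesDeadline d s a
  · have hd : 0 ≤ 1 / (d : ℝ) := by positivity
    linarith [hmiss.expNext_sum_armValue_add_le, drift_coupling_le (d := d) s a]
  by_cases hlate : ∃ i, a = some i ∧ (s i).1 ≠ 2 ∧ timeLeft d (s i) = 0
  · obtain ⟨i, rfl, hi, htime⟩ := hlate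
    have harms : (gapBandit n d).expNext s (some i) (fun s' => ∑ l, armValue d (s' l)) + 1 ≤
        ∑ l, armValue d (s l) := by
      refine expNext_sum_armValue_add_le (l := i) ?_
      rw [expNext_comp_apply_self]
      exact sum_stepProb_mul_armValue_add_one_le_of_missed i hi htime
    linarith [drift_coupling_le_of_late hmiss hi htime]
  · push Not at hlate
    linarith [drift_coupling_le_of_not_late hmiss hlate, expNext_sum_armValue_le (d := d) s a]

theorem optimalReward_gapBandit_le : (gapBandit n d).optimalReward ≤ ((1 / (d : ℝ) : ℝ) : EReal) :=
  optimalReward_le_of_potential _ gapPotential_nonneg drift_gapPotential_le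

theorem half_le_whittleValue_gapBandit : ((1 / 2 : ℝ) : EReal) ≤ (gapBandit d d).whittleValue := by
  have hd : (1 : ℝ) ≤ d := Nat.one_le_cast.2 d.pos
  have hhalf : (d : ℝ) * (2 * (d : ℝ))⁻¹ = 1 / 2 := by field_simp
  rw [← hhalf]
  refine le_whittleValue_gapBandit (by positivity) ?_ ?_
  · field_simp
    exact le_rfl
  · field_simp
    linarith

theorem half_mul_optimalReward_gapBandit_le_whittleValue :
    ((1 / 2 * (d : ℝ) : ℝ) : EReal) * (gapBandit d d).optimalReward ≤
      (gapBandit d d).whittleValue := by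
  have hd : (d : ℝ) ≠ 0 := Nat.cast_ne_zero.2 d.ne_zero
  calc ((1 / 2 * (d : ℝ) : ℝ) : EReal) * (gapBandit d d).optimalReward
      ≤ ((1 / 2 * (d : ℝ) : ℝ) : EReal) * ((1 / (d : ℝ) : ℝ) : EReal) :=
        mul_le_mul_of_nonneg_left optimalReward_gapBandit_le (EReal.coe_nonneg.2 (by positivity))
    _ = ((1 / 2 : ℝ) : EReal) := by
        rw [← EReal.coe_mul]
        congr 1
        field_simp
    _ ≤ (gapBandit d d).whittleValue := half_le_whittleValue_gapBandit

end MonotoneTransitionBandit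

theorem mainTheorem11 :
    ∃ c C : ℝ, 0 < c ∧ 0 < C ∧
      ∀ n : ℕ, 1 ≤ n →
        ∃ B : MonotoneTransitionBandit n 3,
          ¬ B.Separable ∧
          (∀ i, ∃ a, B.IsAbsorbing i a ∧ B.reward i a = 0) ∧
          (c : EReal) ≤ B.whittleValue ∧ B.whittleValue ≤ (C : EReal) ∧
          (∀ (π : MonotoneTransitionBandit.Policy n 3)
              (s : MonotoneTransitionBandit.JointState n 3),
            B.averageReward π s ≤ ((1 / (n : ℝ) : ℝ) : EReal)) ∧
          ((c * (n : ℝ) : ℝ) : EReal) * B.optimalReward ≤ B.whittleValue := by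
  refine ⟨1 / 2, 1, one_half_pos, one_pos, fun n hn => ?_⟩
  lift n to ℕ+ using hn
  refine ⟨.gapBandit n n, MonotoneTransitionBandit.gapBandit_not_separable ⟨0, n.pos⟩, fun i =>
    ⟨2, MonotoneTransitionBandit.gapBandit_isAbsorbing_two i,
      MonotoneTransitionBandit.gapBandit_reward_of_ne_zero i (by decide)⟩,
    MonotoneTransitionBandit.half_le_whittleValue_gapBandit,
    MonotoneTransitionBandit.whittleValue_le_of_reward_le _ zero_le_one
      MonotoneTransitionBandit.gapBandit_reward_le_one,
    fun π s => ?_, MonotoneTransitionBandit.half_mul_optimalReward_gapBandit_le_whittleValue⟩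
  exact (MonotoneTransitionBandit.averageReward_le_optimalReward _ π s).trans
    MonotoneTransitionBandit.optimalReward_gapBandit_le
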